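/- Let $\mathscr{D}$ be a triangulated category and let $\mathfrak{t}$ be a bounded $t$-structure on $\mathscr{D}$ with heart $\heartsuit_{\mathfrak{t}}$. For a $t$-structure $\mathfrak s$ write $\mathscr{D}_{\mathfrak s;\ge 0}$ for its upper subcategory (stable under $[1]$), $\mathscr{D}_{\mathfrak s;<0}$ for its lower subcategory, and $\mathscr{D}_{\mathfrak s;\ge n}=\mathscr{D}_{\mathfrak s;\ge 0}[n]$, $\mathscr{D}_{\mathfrak s;<n}=\mathscr{D}_{\mathfrak s;<0}[n]$; the heart is $\mathscr{D}_{\mathfrak s;\ge 0}\cap\mathscr{D}_{\mathfrak s;<1}$, and $H^n_{\mathfrak t}(X)\in\heartsuit_{\mathfrak t}[n]$ is obtained by truncating $X$ to $\mathscr{D}_{\mathfrak t;\ge n}$ and then to $\mathscr{D}_{\mathfrak t;<n+1}$. Write $\langle\mathscr{S}\rangle$ for the extension-closed full subcategory generated by $\mathscr{S}$ (it always contains the zero objects). For a totally ordered set $J$ with a monotone $\mathbb{Z}$-action $x\mapsto x+n$ satisfying $x\le x+1$, a $J$-slicing assigns to every upper set $V\subseteq J$ a $t$-structure with upper and lower subcategories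 $\mathscr{D}_V$ and $\mathscr{D}_{J\setminus V}$, such that $V\subseteq V'$ implies $\mathscr{D}_V\subseteq\mathscr{D}_{V'}$, and $V+1$ is sent to the shift by $[1]$ of the $t$-structure assigned to $V$. Its slices are $\mathscr{D}_j=\mathscr{D}_{[j,+\infty)}\cap\mathscr{D}_{(-\infty,j]}$, and the cohomology $H^j(X)\in\mathscr{D}_j$ is obtained by truncating $X$ to $\mathscr{D}_{[j,+\infty)}$ and then to $\mathscr{D}_{(-\infty,j]}$. The slicing is Bridgeland if for every $X$ only finitely many $H^j(X)$ are nonzero, and $X=0$ whenever all of them vanish. Let $\tilde{\mathfrak t}$ be an abelian $\mathbb{Z}$-slicing on $\heartsuit_{\mathfrak t}$, i.e. a Bridgeland slicing of $\mathscr{D}$ indexed by $\mathbb{Z}\times\mathbb{Z}$ with the lexicographic order and the action $(n,\phi)+1=(n+1,\phi)$, which assigns $\mathfrak t$ to the upper set $\{(n,\phi): n\ge 0\}$. Put $\heartsuit_{\mathfrak t;\phi}=\mathscr{D}_{(0,\phi)}$, and assume that $\tilde{\mathfrak t}$ is gluable: $\mathrm{Hom}(A,B[n])=0$ for all $A\in\heartsuit_{\mathfrak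 t;\phi}$, $B\in\heartsuit_{\mathfrak t;\psi}$ with $\phi>\psi$ and $n>0$. Let $U$ be an upper set of $\mathbb{Z}\times\mathbb{Z}$ (product order) and let $p$ be the corresponding perversity, i.e. the unique function $p$ which either is a function $\mathbb{Z}\to\mathbb{Z}$ with $p(n)\le p(n+1)\le p(n)+1$ for all $n$, or is constantly $-\infty$ or constantly $+\infty$, such that $U$ is the complement of $\{(-n-n',-n') : n'\ge p(n)-n\}$. Then there is a unique $t$-structure $\mathfrak t_p$ on $\mathscr{D}$ with $$\mathscr{D}_{\mathfrak t_p;\ge 0}=\langle \mathscr{D}_{(n,\phi)}\rangle_{n+p(\phi)\ge 0},\qquad \mathscr{D}_{\mathfrak t_p;<0}=\langle \mathscr{D}_{(n,\phi)}\rangle_{n+p(\phi)<0},$$ and its heart $\heartsuit_p=\heartsuit_U$ (the perverse heart) is the full subcategory of $\mathscr{D}$ on those objects $X$ such that $$H^n_{\mathfrak t}(X)[-n]\in\langle\heartsuit_{\mathfrak t;n'}\rangle_{n'\in p^{-1}(-n)}\qquad\text{for every } n\in\mathbb{Z}.$$ -/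

import Mathlib

open CategoryTheory CategoryTheory.Limits CategoryTheory.Pretriangulated
open CategoryTheory.Triangulated

universe v u w

namespace Perverse

/-! ### Posets with an action of the integers -/

/-- A `ℤ`-toset structure on a totally ordered set `J`: an order automorphism `shift`, written
`x ↦ x + 1`, with `x ≤ x + 1`; its iterates form the monotone action of `ℤ`. -/
structure ZAction (J : Type w) [LinearOrder J] where
  shift : J ≃o J
  le_shift : ∀ x, x ≤ shift x

/-- The totally ordered set `ℤ ×_lex ℤ̂`. -/
abbrev LexIndex : Type := ℤ ×ₗ ℤ

/-- The action of `ℤ` on `ℤ ×_lex ℤ̂`: translation on the first factor, trivial on the second. -/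
def lexAction : ZAction LexIndex where
  shift :=
    { toFun := fun x => toLex ((ofLex x).1 + 1, (ofLex x).2)
      invFun := fun x => toLex ((ofLex x).1 - 1, (ofLex x).2)
      left_inv := fun x => by simp
      right_inv := fun x => by simp
      map_rel_iff' := by
        intro a b
        simp [Prod.Lex.le_iff] }
  le_shift := fun x => by simp [Prod.Lex.le_iff]

/-- The preimage of `[0, +∞)` under the projection `ℤ ×_lex ℤ̂ → ℤ`. -/
def nonnegUpperSet : UpperSet LexIndex where
  carrier := {x | 0 ≤ (ofLex x).1}
  upper' := by
    intro a b hab ha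
    have h := Prod.Lex.le_iff.1 hab
    simp only [Set.mem_ofPred_eq] at ha ⊢
    omega

/-! ### Perversities -/

/-- A perversity function: `p(n) ≤ p(n+1) ≤ p(n) + 1` for every integer `n`. -/
def IsPerversityFunction (q : ℤ → ℤ) : Prop :=
  ∀ n, q n ≤ q (n + 1) ∧ q (n + 1) ≤ q n + 1

/-- Perversity functions together with the constants `-∞` and `+∞`. -/
def IsExtendedPerversity (p : ℤ → EInt) : Prop :=
  (∃ q : ℤ → ℤ, IsPerversityFunction q ∧ ∀ n, p n = (q n : EInt)) ∨
    (∀ n, p n = ⊥) ∨ (∀ n, p n = ⊤)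

/-- The set of all `(n, n')` with `n' ≥ p(n) - n`. -/
def perversityRegion (p : ℤ → EInt) : Set (ℤ × ℤ) :=
  {x | p x.1 ≤ ((x.1 + x.2 : ℤ) : EInt)}

/-- The automorphism `(n, n') ↦ (-n-n', -n')` of `ℤ × ℤ`. -/
def psi (x : ℤ × ℤ) : ℤ × ℤ := (-x.1 - x.2, -x.2)

/-- The extended perversity `p` corresponds to the upper set `U` of `ℤ × ℤ` (with the product
order): `U` is the complement of the image under `psi` of the set of `(n, n')` with
`n' ≥ p(n) - n`. -/
def Corresponds (p : ℤ → EInt) (U : UpperSet (ℤ × ℤ)) : Prop :=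
  (U : Set (ℤ × ℤ)) = (psi '' perversityRegion p)ᶜ

theorem corresponds_iff (p : ℤ → EInt) (U : UpperSet (ℤ × ℤ)) :
    Corresponds p U ↔ ∀ n m : ℤ, p n ≤ (m : EInt) ↔ (-m, n - m) ∉ U := by
  have key : ∀ n m : ℤ, (-m, n - m) ∈ psi '' perversityRegion p ↔ p n ≤ (m : EInt) := by
    intro n m
    constructor
    · rintro ⟨⟨a, b⟩, h, e⟩
      simp only [psi, Prod.mk.injEq] at e
      have h' : p a ≤ ((a + b : ℤ) : EInt) := h
      have ha : a = n := by omega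
      have hb : a + b = m := by omega
      rw [hb, ha] at h'
      exact h'
    · intro h
      refine ⟨(n, m - n), ?_, ?_⟩
      · change p n ≤ ((n + (m - n) : ℤ) : EInt)
        rw [show n + (m - n) = m by omega]
        exact h
      · simp only [psi, Prod.mk.injEq]
        omega
  constructor
  · intro h n m
    rw [← key n m, ← SetLike.mem_coe, h, Set.mem_compl_iff, not_not]
  · intro h
    ext ⟨a, b⟩
    have h1 := key (b - a) (-a)
    have h2 := h (b - a) (-a)
    have e : ((- -a : ℤ), b - a - -a) = (a, b) := by ext <;> simp
    rw [e] at h1 h2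
    rw [Set.mem_compl_iff, h1, h2, not_not, SetLike.mem_coe]

theorem eint_ext {x y : EInt} (h : ∀ m : ℤ, x ≤ (m : EInt) ↔ y ≤ (m : EInt)) : x = y := by
  have key : ∀ z : EInt, z = ⊥ ∨ z = ⊤ ∨ ∃ a : ℤ, z = (a : EInt) := by
    intro z
    induction z using WithBotTop.rec with
    | bot => exact Or.inl rfl
    | coe a => exact Or.inr (Or.inr ⟨a, rfl⟩)
    | top => exact Or.inr (Or.inl rfl)
  rcases key x with rfl | rfl | ⟨a, rfl⟩ <;> rcases key y with rfl | rfl | ⟨b, rfl⟩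
  · rfl
  · simpa using h 0
  · have := h (b - 1)
    simp at this
  · simpa using h 0
  · rfl
  · have := h b
    simp at this
  · have := h (a - 1)
    simp at this
  · have := h a
    simp at this
  · have h1 := h a
    have h2 := h b
    simp only [WithBotTop.coe_le_coe] at h1 h2
    rw [le_antisymm (h2.2 le_rfl) (h1.1 le_rfl)]

/-- Every upper set of `ℤ × ℤ` corresponds to exactly one extended perversity. -/
theorem existsUnique_perversity (U : UpperSet (ℤ × ℤ)) :
    ∃! p : ℤ → EInt, IsExtendedPerversity p ∧ Corresponds p U := by
  refine existsUnique_of_exists_of_unique ?_ ?_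
  · by_cases h0 : ∃ u, u ∈ U
    · by_cases h1 : ∃ w, w ∉ U
      · obtain ⟨⟨a, b⟩, hu⟩ := h0
        obtain ⟨⟨c, d⟩, hv⟩ := h1
        have hex : ∀ n : ℤ, ∃ k : ℤ, (-k, n - k) ∉ U ∧ ∀ m : ℤ, (-m, n - m) ∉ U → k ≤ m := by
          intro n
          refine Int.exists_least_of_bdd (P := fun m => (-m, n - m) ∉ U)
            ⟨min (-a) (n - b), fun m hm => ?_⟩ ⟨max (-c) (n - d), fun hm => hv ?_⟩
          · by_contra hlt
            refine hm (U.upper (a := (a, b)) (Prod.mk_le_mk.2 ⟨?_, ?_⟩) hu) <;> omega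
          · refine U.upper (Prod.mk_le_mk.2 ⟨?_, ?_⟩) hm <;> omega
        choose q hq hq' using hex
        refine ⟨fun n => (q n : EInt), Or.inl ⟨q, fun n => ⟨?_, ?_⟩, fun _ => rfl⟩, ?_⟩
        · refine hq' n _ fun hm => hq (n + 1) (U.upper (Prod.mk_le_mk.2 ⟨?_, ?_⟩) hm) <;> omega
        · refine hq' (n + 1) _ fun hm => hq n (U.upper (Prod.mk_le_mk.2 ⟨?_, ?_⟩) hm) <;> omega
        · rw [corresponds_iff]
          intro n m
          rw [WithBotTop.coe_le_coe]
          refine ⟨fun h hm => hq n (U.upper (Prod.mk_le_mk.2 ⟨?_, ?_⟩) hm), hq' n m⟩ <;> omega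
      · push Not at h1
        refine ⟨fun _ => ⊤, Or.inr (Or.inr fun _ => rfl), ?_⟩
        rw [corresponds_iff]
        intro n m
        simp [h1]
    · push Not at h0
      refine ⟨fun _ => ⊥, Or.inr (Or.inl fun _ => rfl), ?_⟩
      rw [corresponds_iff]
      intro n m
      simp [h0]
  · rintro p₁ p₂ ⟨-, h₁⟩ ⟨-, h₂⟩
    rw [corresponds_iff] at h₁ h₂
    funext n
    exact eint_ext fun m => by rw [h₁, h₂]

/-- The extended perversity corresponding to an upper set of `ℤ × ℤ`. -/
noncomputable def perversityOf (U : UpperSet (ℤ × ℤ)) : ℤ → EInt :=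
  (existsUnique_perversity U).choose

/-! ### Slicings of a triangulated category

Dictionary: for a t-structure `s` with upper subcategory `D_{≥ 0}` (the one stable under `[1]`)
and lower subcategory `D_{< 0}`, one has `D_{≥ 0} = s.le 0` and `D_{< 0} = s.ge 1`; more generally
`D_{≥ n} = D_{≥ 0}[n] = s.le (-n)` and `D_{≤ n} = s.ge (-n)`. -/

section

variable {C : Type u} [Category.{v} C] [Preadditive C] [HasZeroObject C] [HasShift C ℤ]
  [∀ n : ℤ, (shiftFunctor C n).Additive] [Pretriangulated C]

/-- The shift `s + 1` of a t-structure, whose upper subcategory is `D_{≥ 0}[1]`. -/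
def shiftTStructure (s : TStructure C) : TStructure C where
  le n := s.le (n - 1)
  ge n := s.ge (n - 1)
  le_shift n a n' h X hX := s.le_shift (n - 1) a (n' - 1) (by omega) X hX
  ge_shift n a n' h X hX := s.ge_shift (n - 1) a (n' - 1) (by omega) X hX
  zero' X Y f hX hY := by
    have : s.IsLE X (0 - 1) := ⟨hX⟩
    have : s.IsGE Y (1 - 1) := ⟨hY⟩
    exact s.zero f (0 - 1) (1 - 1)
  le_zero_le := s.le_monotone (by omega)
  ge_one_le := s.ge_antitone (by omega)
  exists_triangle_zero_one A := s.exists_triangle A (0 - 1) (1 - 1) (by omega)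

/-- The extension-closed subcategory `⟨P⟩` generated by `P`: the smallest full subcategory that
contains the zero objects and the objects of `P` and is closed under extensions. -/
inductive extClosure (P : ObjectProperty C) : C → Prop
  | zero (X : C) (hX : IsZero X) : extClosure P X
  | of (X : C) (hX : P X) : extClosure P X
  | ext (X Y Z : C) (f : X ⟶ Y) (g : Y ⟶ Z) (h : Z ⟶ X⟦(1 : ℤ)⟧)
      (hT : Triangle.mk f g h ∈ distTriang C) (hX : extClosure P X) (hZ : extClosure P Z) :
      extClosure P Y

variable (C) in
/-- A `J`-slicing of `C`: a monotone `ℤ`-equivariant map from the upper sets of `J` (ordered by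
reverse inclusion) to the t-structures on `C` (ordered by reverse inclusion of the upper
subcategories). -/
structure Slicing (J : Type w) [LinearOrder J] (a : ZAction J) where
  ts : UpperSet J → TStructure C
  monotone_ts : ∀ U V : UpperSet J, U ≤ V → (ts V).le 0 ≤ (ts U).le 0
  ts_shift : ∀ U : UpperSet J, ts (UpperSet.map a.shift U) = shiftTStructure (ts U)

namespace Slicing

variable {J : Type w} [LinearOrder J] {a : ZAction J} (S : Slicing C J a)

/-- The slice `D_φ = D_{≥ φ} ∩ D_{≤ φ}`. -/
def slice (φ : J) : ObjectProperty C :=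
  (S.ts (UpperSet.Ici φ)).le 0 ⊓ (S.ts (UpperSet.Ioi φ)).ge 1

/-- The cohomology functor `H^φ`: truncate to `D_{≥ φ}`, then to `D_{≤ φ}`. -/
noncomputable def cohomology (φ : J) : C ⥤ C :=
  (S.ts (UpperSet.Ici φ)).truncLE 0 ⋙ (S.ts (UpperSet.Ioi φ)).truncGE 1

/-- A Bridgeland slicing: every object has finitely many nonzero cohomologies, and an object
all of whose cohomologies vanish is zero. -/
def IsBridgeland : Prop :=
  ∀ X : C, {φ : J | ¬ IsZero ((S.cohomology φ).obj X)}.Finite ∧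
    ((∀ φ : J, IsZero ((S.cohomology φ).obj X)) → IsZero X)

end Slicing

/-- The cohomology `H^n_t`, truncating to `D_{≥ n}` and then to `D_{≤ n}`; it takes values
in `♥_t[n]`. -/
noncomputable def tCohomology (t : TStructure C) (n : ℤ) : C ⥤ C :=
  t.truncLE (-n) ⋙ t.truncGE (-n)

/-- An abelian `ℤ`-slicing on the heart of `t`: a Bridgeland `ℤ ×_lex ℤ̂`-slicing of `C` which
extends `t` along the projection `ℤ ×_lex ℤ̂ → ℤ`. -/
structure AbelianSlicing (t : TStructure C) extends Slicing C LexIndex lexAction where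
  isBridgeland : toSlicing.IsBridgeland
  ts_nonneg : ts nonnegUpperSet = t

namespace AbelianSlicing

variable {t : TStructure C} (S : AbelianSlicing t)

/-- The slice `D_{(n, φ)}`. -/
def sliceAt (n φ : ℤ) : ObjectProperty C := S.toSlicing.slice (toLex (n, φ))

/-- The slice `♥_{t;φ} = D_{(0, φ)}` of the heart. -/
def heartSlice (φ : ℤ) : ObjectProperty C := S.sliceAt 0 φ

/-- The slicing is gluable: all morphisms from `♥_{t;φ}` to `♥_{t;ψ}[n]` vanish for `φ > ψ`
and `n > 0`. -/
def IsGluable : Prop :=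
  ∀ φ ψ n : ℤ, ψ < φ → 0 < n → ∀ X Y : C, S.heartSlice φ X → S.heartSlice ψ Y →
    ∀ f : X ⟶ Y⟦n⟧, f = 0

/-- The t-structure `s` is the perverse t-structure of `p`: its upper subcategory is
`⟨D_{(n, φ)} : n + p(φ) ≥ 0⟩` and its lower subcategory is `⟨D_{(n, φ)} : n + p(φ) < 0⟩`. -/
def IsPerverseTStructure (p : ℤ → EInt) (s : TStructure C) : Prop :=
  s.le 0 = extClosure (fun X => ∃ n φ : ℤ, ((-n : ℤ) : EInt) ≤ p φ ∧ S.sliceAt n φ X) ∧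
  s.ge 1 = extClosure (fun X => ∃ n φ : ℤ, p φ < ((-n : ℤ) : EInt) ∧ S.sliceAt n φ X)

end AbelianSlicing

end

end Perverse

namespace Perverse

/-! ### Extensions and extension-closed subcategories -/

section

variable {C : Type u} [Category.{v} C] [Preadditive C] [HasZeroObject C] [HasShift C ℤ]
  [∀ n : ℤ, (shiftFunctor C n).Additive] [Pretriangulated C]

/-! Let `A` be the set of pairs (n, φ) with n + p(φ) ≥ 0. Since p is monotone, `A` is an upper set
for the product order, so (n, φ) ∈ A, (m, ψ) ∉ A and n ≤ m force ψ < φ. Gluability then gives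
Hom(D_(n,φ), D_(m,ψ)) = 0 if n < m, and Hom(D_(n,φ), D_(m,ψ)[1]) = 0 if n ≤ m. If n ≥ m, the first
group vanishes because (n, φ) is lexicographically larger than (m, ψ). Hence the two candidate
halves are orthogonal.

Truncation triangles come from reordering. The Bridgeland condition makes every object a finite
iterated extension of slice objects, with the larger indices on the left. The vanishing of Hom(D_i,
D_j[1]) for i < j, i ∈ A, j ∉ A (`ExtVanishing`) splits the extensions that stand in the wrong
order, so all factors in `A` can be moved to the left (`IsBridgeland.exists_isExtension`).

For the heart, the truncations of the slicing preserve both halves of the glued t-structure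
(`isLE_truncations`, `isGE_truncations`). So the `t`-cohomologies of an object of the heart lie in
the heart, and splitting off lowest cohomologies shows that they are built from slices with (n, φ) ∈
A and (n - 1, φ) ∉ A, that is, p(φ) = -n. Conversely, as `t` is bounded, an object is an iterated
extension of its `t`-cohomologies. -/

/-- `Y` is an extension of `Z` by `X`. -/
def IsExtension (X Y Z : C) : Prop :=
  ∃ (f : X ⟶ Y) (g : Y ⟶ Z) (h : Z ⟶ X⟦(1 : ℤ)⟧), Triangle.mk f g h ∈ distTriang C

namespace IsExtension

/-- The octahedral axiom. With `assoc_left`, it allows iterated extensions to be rebracketed without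
tracking morphisms. -/
lemma assoc_right [IsTriangulated C] {A X B Y Z : C} (h₁ : IsExtension A X B)
    (h₂ : IsExtension X Y Z) : ∃ N, IsExtension A Y N ∧ IsExtension B N Z := by
  obtain ⟨f, g, h, hT⟩ := h₁
  obtain ⟨f', g', h', hT'⟩ := h₂
  obtain ⟨N, v, w, hN⟩ := distinguished_cocone_triangle (f ≫ f')
  exact ⟨N, ⟨_, _, _, hN⟩, _, _, _, (someOctahedron rfl hT hT' hN).mem⟩

lemma assoc_left [IsTriangulated C] {A Y N B Z : C} (h₁ : IsExtension A Y N)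
    (h₂ : IsExtension B N Z) : ∃ X, IsExtension A X B ∧ IsExtension X Y Z := by
  obtain ⟨f, g, h, hT⟩ := h₁
  obtain ⟨f', g', h', hT'⟩ := h₂
  obtain ⟨X, v, w, hX⟩ := distinguished_cocone_triangle₁ (g ≫ g')
  exact ⟨X, ⟨_, _, _, (someOctahedron' rfl hT hT' hX).mem⟩, _, _, _, hX⟩

lemma of_isZero_right (X : C) {Z : C} (hZ : IsZero Z) : IsExtension X X Z := by
  refine ⟨𝟙 X, 0, 0, ?_⟩
  rw [Triangle.distinguished_iff_of_isZero₃ _ hZ]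
  exact inferInstanceAs (IsIso (𝟙 X))

lemma of_isZero_left {Z : C} (X : C) (hZ : IsZero Z) : IsExtension Z X X := by
  refine ⟨0, 𝟙 X, 0, ?_⟩
  rw [Triangle.distinguished_iff_of_isZero₁ _ hZ]
  exact inferInstanceAs (IsIso (𝟙 X))

lemma rotate {X Y Z : C} (h : IsExtension X Y Z) : IsExtension Y Z (X⟦(1 : ℤ)⟧) := by
  obtain ⟨f, g, h, hT⟩ := h
  exact ⟨_, _, _, rot_of_distTriang _ hT⟩

lemma invRotate {X Y Z : C} (h : IsExtension X Y Z) : IsExtension (Z⟦(-1 : ℤ)⟧) X Y := by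
  obtain ⟨f, g, h, hT⟩ := h
  exact ⟨_, _, _, inv_rot_of_distTriang _ hT⟩

lemma shift {X Y Z : C} (h : IsExtension X Y Z) (n : ℤ) :
    IsExtension (X⟦n⟧) (Y⟦n⟧) (Z⟦n⟧) := by
  obtain ⟨f, g, h, hT⟩ := h
  exact ⟨_, _, _, Triangle.shift_distinguished _ hT n⟩

/-- The connecting morphism vanishes, so the triangle splits and the two summands can be exchanged.
This is what reorders slices. -/
lemma swap {X Y Z : C} (h : IsExtension X Y Z) (h0 : ∀ f : Z ⟶ X⟦(1 : ℤ)⟧, f = 0) :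
    IsExtension Z Y X := by
  obtain ⟨f, g, h, hT⟩ := h
  obtain ⟨e, -, -⟩ := exists_iso_binaryBiproduct_of_distTriang _ hT (h0 h)
  let e' : Y ≅ Z ⊞ X := e ≪≫ biprod.braiding _ _
  refine ⟨biprod.inl ≫ e'.inv, e'.hom ≫ biprod.snd, 0,
    isomorphic_distinguished _ (binaryBiproductTriangle_distinguished Z X) _ ?_⟩
  exact Triangle.isoMk _ _ (Iso.refl Z) e' (Iso.refl X)
    (show (biprod.inl ≫ e'.inv) ≫ e'.hom = 𝟙 Z ≫ biprod.inl by simp)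
    (show (e'.hom ≫ biprod.snd) ≫ 𝟙 X = e'.hom ≫ biprod.snd by simp)
    (show (0 : X ⟶ Z⟦(1 : ℤ)⟧) ≫ (𝟙 Z)⟦(1 : ℤ)⟧' = 𝟙 X ≫ 0 by simp)

lemma hom_from_eq_zero {X Y Z W : C} (h : IsExtension X Y Z) (hX : ∀ f : X ⟶ W, f = 0)
    (hZ : ∀ f : Z ⟶ W, f = 0) (f : Y ⟶ W) : f = 0 := by
  obtain ⟨u, v, w, hT⟩ := h
  obtain ⟨g, hg⟩ : ∃ g : Z ⟶ W, f = v ≫ g := Triangle.yoneda_exact₂ _ hT f (hX _)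
  rw [hg, hZ g, comp_zero]

lemma hom_to_eq_zero {X Y Z W : C} (h : IsExtension X Y Z) (hX : ∀ f : W ⟶ X, f = 0)
    (hZ : ∀ f : W ⟶ Z, f = 0) (f : W ⟶ Y) : f = 0 := by
  obtain ⟨u, v, w, hT⟩ := h
  obtain ⟨g, hg⟩ : ∃ g : W ⟶ X, f = g ≫ u := Triangle.coyoneda_exact₂ _ hT f (hZ _)
  rw [hg, hX g, zero_comp]

end IsExtension

lemma isLE_of_isExtension (t : TStructure C) {X Y Z : C} (h : IsExtension X Y Z) (n : ℤ)
    (hX : t.IsLE X n) (hZ : t.IsLE Z n) : t.IsLE Y n := by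
  obtain ⟨_, _, _, hT⟩ := h
  exact t.isLE₂ _ hT n hX hZ

lemma isGE_of_isExtension (t : TStructure C) {X Y Z : C} (h : IsExtension X Y Z) (n : ℤ)
    (hX : t.IsGE X n) (hZ : t.IsGE Z n) : t.IsGE Y n := by
  obtain ⟨_, _, _, hT⟩ := h
  exact t.isGE₂ _ hT n hX hZ

lemma isLE_of_isZero (t : TStructure C) {X : C} (h : IsZero X) (n : ℤ) : t.IsLE X n :=
  (t.isLE_iff_orthogonal n _ rfl X).2 fun _ _ _ => h.eq_of_src _ _

lemma isGE_of_isZero (t : TStructure C) {X : C} (h : IsZero X) (n : ℤ) : t.IsGE X n :=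
  (t.isGE_iff_orthogonal (n - 1) _ (by omega) X).2 fun _ _ _ => h.eq_of_tgt _ _

lemma isExtension_truncLE_truncGE (t : TStructure C) (X : C) (a b : ℤ) (h : a + 1 = b) :
    IsExtension ((t.truncLE a).obj X) X ((t.truncGE b).obj X) :=
  ⟨_, _, _, t.triangleLEGE_distinguished a b h X⟩

/-- Truncation triangles are unique. -/
lemma nonempty_iso_of_isExtension (t : TStructure C) {A A' X B B' : C}
    (h : IsExtension A X B) (h' : IsExtension A' X B') (a b : ℤ) (hab : a < b)
    (hA : t.IsLE A a) (hB : t.IsGE B b) (hA' : t.IsLE A' a) (hB' : t.IsGE B' b) :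
    Nonempty (A ≅ A') ∧ Nonempty (B ≅ B') := by
  obtain ⟨_, _, _, hT⟩ := h
  obtain ⟨_, _, _, hT'⟩ := h'
  obtain ⟨e, -⟩ := t.triangle_iso_exists hT hT' (Iso.refl _) a b hA hB hA' hB' hab
  exact ⟨⟨Triangle.π₁.mapIso e⟩, ⟨Triangle.π₃.mapIso e⟩⟩

namespace extClosure

variable {P Q : ObjectProperty C}

lemma ofIsExtension {X Y Z : C} (h : IsExtension X Y Z) (hX : extClosure P X)
    (hZ : extClosure P Z) : extClosure P Y := by
  obtain ⟨f, g, h, hT⟩ := h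
  exact ext X Y Z f g h hT hX hZ

/-- Extension closures are the smallest classes that contain the zero objects, the generators and
are closed under extensions. -/
lemma induct {R : C → Prop} (h0 : ∀ X, IsZero X → R X) (hP : ∀ X, P X → R X)
    (hext : ∀ X Y Z, IsExtension X Y Z → R X → R Z → R Y) {X : C} (hX : extClosure P X) : R X := by
  induction hX with
  | zero X h => exact h0 X h
  | of X h => exact hP X h
  | ext X Y Z f g h hT _ _ h₁ h₂ => exact hext X Y Z ⟨f, g, h, hT⟩ h₁ h₂

lemma bind {X : C} (hX : extClosure P X) (h : ∀ X, P X → extClosure Q X) : extClosure Q X :=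
  hX.induct .zero h fun _ _ _ => ofIsExtension

lemma mono {X : C} (hX : extClosure P X) (h : ∀ X, P X → Q X) : extClosure Q X :=
  hX.bind fun X hX => .of X (h X hX)

lemma of_iso {X Y : C} (e : X ≅ Y) (hX : extClosure P X) : extClosure P Y := by
  obtain ⟨Z, hZ⟩ := HasZeroObject.zero (C := C)
  refine .ext X Y Z e.hom 0 0 ?_ hX (.zero _ hZ)
  rw [Triangle.distinguished_iff_of_isZero₃ _ hZ]
  exact inferInstanceAs (IsIso e.hom)

instance : ObjectProperty.IsClosedUnderIsomorphisms (extClosure P) where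
  of_iso e h := h.of_iso e

lemma shift {X : C} (hX : extClosure P X) (n : ℤ) (h : ∀ X, P X → Q (X⟦n⟧)) :
    extClosure Q (X⟦n⟧) :=
  hX.induct (R := fun X => extClosure Q (X⟦n⟧))
    (fun _ h => .zero _ ((shiftFunctor C n).map_isZero h)) (fun X hX => .of _ (h X hX))
    fun _ _ _ h => ofIsExtension (h.shift n)

lemma hom_eq_zero {X Y : C} (hX : extClosure P X) (hY : extClosure Q Y)
    (h : ∀ X Y, P X → Q Y → ∀ f : X ⟶ Y, f = 0) (f : X ⟶ Y) : f = 0 := by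
  revert f
  refine hX.induct (R := fun X => ∀ f : X ⟶ Y, f = 0) (fun X hX f => hX.eq_of_src _ _)
    (fun X hX => ?_) fun _ _ _ hT => hT.hom_from_eq_zero
  exact hY.induct (R := fun Y => ∀ f : X ⟶ Y, f = 0) (fun Y hY f => hY.eq_of_tgt _ _)
    (fun Y hY => h X Y hX hY) fun _ _ _ hT => hT.hom_to_eq_zero

lemma hom_shift_eq_zero {X Y : C} (n : ℤ) (hX : extClosure P X) (hY : extClosure Q Y)
    (h : ∀ X Y, P X → Q Y → ∀ f : X ⟶ Y⟦n⟧, f = 0) (f : X ⟶ Y⟦n⟧) : f = 0 := by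
  refine hX.hom_eq_zero (hY.shift (Q := fun Z => ∃ Y, Q Y ∧ Z = Y⟦n⟧) n
    fun Y hY => ⟨Y, hY, rfl⟩) ?_ f
  rintro X _ hX ⟨Y, hY, rfl⟩
  exact h X Y hX hY

end extClosure

/-! ### Cohomologies of a slicing and truncations -/

namespace Slicing

variable {J : Type w} [LinearOrder J] {a : ZAction J} (S : Slicing C J a)

/-- `UpperSet` is ordered by reverse inclusion: `U ≤ V` means V ⊆ U as sets. -/
lemma isLE_ts_of_le {U V : UpperSet J} (h : U ≤ V) {X : C} (hX : (S.ts V).IsLE X 0) :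
    (S.ts U).IsLE X 0 :=
  ⟨S.monotone_ts U V h X hX.le⟩

lemma isGE_ts_of_le {U V : UpperSet J} (h : U ≤ V) {X : C} (hX : (S.ts U).IsGE X 1) :
    (S.ts V).IsGE X 1 := by
  rw [TStructure.isGE_iff_orthogonal _ 0 1 (by omega)] at hX ⊢
  exact fun Y f hY => hX Y f (S.isLE_ts_of_le h hY)

/-- By uniqueness of truncations `W` is the truncation of `X` to D_{≥ j}, and the cohomology at `j`
is what remains of `W` after removing its part in D_{> j}. -/
lemma isZero_cohomology_iff {j : J} {W X V : C} (h : IsExtension W X V)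
    (hW : (S.ts (UpperSet.Ici j)).IsLE W 0) (hV : (S.ts (UpperSet.Ici j)).IsGE V 1) :
    IsZero ((S.cohomology j).obj X) ↔ (S.ts (UpperSet.Ioi j)).IsLE W 0 := by
  obtain ⟨⟨e⟩, -⟩ := nonempty_iso_of_isExtension _ h
    (isExtension_truncLE_truncGE (S.ts (UpperSet.Ici j)) X 0 1 (by omega)) 0 1 (by omega) hW hV
    inferInstance inferInstance
  refine ((S.ts (UpperSet.Ioi j)).isLE_iff_isZero_truncGE_obj 0 1 (by omega) _).symm.trans
    ⟨fun h => TStructure.isLE_of_iso _ e.symm 0, fun h => TStructure.isLE_of_iso _ e 0⟩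

lemma exists_isExtension (V : UpperSet J) (X : C) :
    ∃ P Q, (S.ts V).IsLE P 0 ∧ (S.ts V).IsGE Q 1 ∧ IsExtension P X Q :=
  ⟨_, _, inferInstance, inferInstance, isExtension_truncLE_truncGE (S.ts V) X 0 1 (by omega)⟩

lemma isZero_cohomology_of_isLE {V : UpperSet J} {X : C} (hX : (S.ts V).IsLE X 0) {j : J}
    (hj : j ∉ V) : IsZero ((S.cohomology j).obj X) := by
  have h₁ : UpperSet.Ioi j ≤ V := fun k hk => lt_of_not_ge fun hkj => hj (V.upper hkj hk)
  have h₂ : UpperSet.Ici j ≤ UpperSet.Ioi j := fun k hk => le_of_lt hk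
  rw [S.isZero_cohomology_iff (.of_isZero_right X (isZero_zero C))
    (S.isLE_ts_of_le (h₂.trans h₁) hX) (isGE_of_isZero _ (isZero_zero C) _)]
  exact S.isLE_ts_of_le h₁ hX

lemma le_Ici {V : UpperSet J} {j : J} (hj : j ∈ V) : V ≤ UpperSet.Ici j :=
  fun _ hk => V.upper hk hj

lemma isZero_cohomology_of_isGE {V : UpperSet J} {X : C} (hX : (S.ts V).IsGE X 1) {j : J}
    (hj : j ∈ V) : IsZero ((S.cohomology j).obj X) := by
  rw [S.isZero_cohomology_iff (.of_isZero_left X (isZero_zero C))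
    (isLE_of_isZero _ (isZero_zero C) _) (S.isGE_ts_of_le (le_Ici hj) hX)]
  exact isLE_of_isZero _ (isZero_zero C) _

/-- The indices of the nonzero cohomologies of `X`. -/
def support (X : C) : Set J := {j | ¬ IsZero ((S.cohomology j).obj X)}

lemma support_subset_of_isLE {V : UpperSet J} {X : C} (hX : (S.ts V).IsLE X 0) :
    S.support X ⊆ V :=
  fun _ hj => by_contra fun h => hj (S.isZero_cohomology_of_isLE hX h)

lemma support_subset_of_isGE {V : UpperSet J} {X : C} (hX : (S.ts V).IsGE X 1) :
    S.support X ⊆ (V : Set J)ᶜ :=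
  fun _ hj h => hj (S.isZero_cohomology_of_isGE hX h)

variable {S} in
lemma IsBridgeland.isZero (hS : S.IsBridgeland) {X : C} (hX : S.support X ⊆ ∅) : IsZero X :=
  (hS X).2 fun _ => by_contra fun h => hX h

variable [IsTriangulated C]

/-- For `j ∈ V` the object `Q` lies in D_{< j}, so `P` and `X` have the same truncation to D_{≥ j};
for `j ∉ V` the cohomology of `P` vanishes anyway. -/
lemma isZero_cohomology_left {V : UpperSet J} {P X Q : C} (hP : (S.ts V).IsLE P 0)
    (hQ : (S.ts V).IsGE Q 1) (h : IsExtension P X Q) {j : J}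
    (hj : IsZero ((S.cohomology j).obj X)) : IsZero ((S.cohomology j).obj P) := by
  by_cases hjV : j ∈ V
  · obtain ⟨W, V', hW, hV', hT⟩ := S.exists_isExtension (UpperSet.Ici j) P
    obtain ⟨N, h₁, h₂⟩ := hT.assoc_right h
    rw [S.isZero_cohomology_iff hT hW hV']
    rwa [S.isZero_cohomology_iff h₁ hW] at hj
    exact isGE_of_isExtension _ h₂ 1 hV' (S.isGE_ts_of_le (le_Ici hjV) hQ)
  · exact S.isZero_cohomology_of_isLE hP hjV

lemma isZero_cohomology_right {V : UpperSet J} {P X Q : C} (hP : (S.ts V).IsLE P 0)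
    (hQ : (S.ts V).IsGE Q 1) (h : IsExtension P X Q) {j : J}
    (hj : IsZero ((S.cohomology j).obj X)) : IsZero ((S.cohomology j).obj Q) := by
  by_cases hjV : j ∈ V
  · exact S.isZero_cohomology_of_isGE hQ hjV
  · have h₁ : UpperSet.Ioi j ≤ V := fun k hk => lt_of_not_ge fun hkj => hjV (V.upper hkj hk)
    have h₂ : UpperSet.Ici j ≤ UpperSet.Ioi j := fun k hk => le_of_lt hk
    obtain ⟨W, V', hW, hV', hT⟩ := S.exists_isExtension (UpperSet.Ici j) Q
    -- `E` is the truncation of `X` to D_{≥ j}, an extension of `W` by `P`. If `E` is in D_{> j}, so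
    -- is `W`, as an extension of P[1] by `E`.
    obtain ⟨E, h₃, h₄⟩ := h.assoc_left hT
    rw [S.isZero_cohomology_iff hT hW hV']
    have hP' := S.isLE_ts_of_le h₁ hP
    rw [S.isZero_cohomology_iff h₄
      (isLE_of_isExtension _ h₃ 0 (S.isLE_ts_of_le h₂ hP') hW) hV'] at hj
    refine isLE_of_isExtension _ h₃.rotate 0 hj ?_
    have := (S.ts (UpperSet.Ioi j)).isLE_shift P 0 1 (-1)
    exact TStructure.isLE_of_le _ _ (-1) 0

lemma support_left {V : UpperSet J} {P X Q : C} (hP : (S.ts V).IsLE P 0)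
    (hQ : (S.ts V).IsGE Q 1) (h : IsExtension P X Q) : S.support P ⊆ S.support X ∩ V :=
  Set.subset_inter (fun _ hj hX => hj (S.isZero_cohomology_left hP hQ h hX))
    (S.support_subset_of_isLE hP)

lemma support_right {V : UpperSet J} {P X Q : C} (hP : (S.ts V).IsLE P 0)
    (hQ : (S.ts V).IsGE Q 1) (h : IsExtension P X Q) : S.support Q ⊆ S.support X ∩ (V : Set J)ᶜ :=
  Set.subset_inter (fun _ hj hX => hj (S.isZero_cohomology_right hP hQ h hX))
    (S.support_subset_of_isGE hQ)

variable {S}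

/-- The part of `X` in D_{< j} has empty support, hence is zero by the Bridgeland condition. -/
lemma IsBridgeland.slice_of_support (hS : S.IsBridgeland) {X : C} {j : J}
    (hX : (S.ts (UpperSet.Ioi j)).IsGE X 1) (h : S.support X ⊆ {j}) : S.slice j X := by
  refine ⟨?_, hX.ge⟩
  obtain ⟨P, Q, hP, hQ, hT⟩ := S.exists_isExtension (UpperSet.Ici j) X
  have hQ0 : IsZero Q := by
    refine hS.isZero fun i hi => ?_
    obtain ⟨h₁, h₂⟩ := S.support_right hP hQ hT hi
    obtain rfl : i = j := h h₁
    exact h₂ le_rfl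
  exact (isLE_of_isExtension _ hT 0 hP (isLE_of_isZero _ hQ0 0)).le

/-- Split off the lowest cohomology of an object. -/
lemma IsBridgeland.induction (hS : S.IsBridgeland) {R : Set J → C → Prop}
    (h0 : ∀ X, IsZero X → R ∅ X)
    (hstep : ∀ (s : Set J) (j : J) (X P L : C), (∀ i ∈ s, j < i) → S.slice j L →
      (S.ts (UpperSet.Ioi j)).IsLE P 0 → (S.ts (UpperSet.Ioi j)).IsGE L 1 →
      IsExtension P X L → R s P → R (insert j s) X)
    (F : Finset J) : ∀ X, S.support X ⊆ F → R F X := by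
  classical
  induction F using Finset.induction_on_min with
  | empty => exact fun X hX => by simpa using h0 X (hS.isZero (by simpa using hX))
  | insert j F hj ih =>
    intro X hX
    obtain ⟨P, L, hP, hL, hT⟩ := S.exists_isExtension (UpperSet.Ioi j) X
    rw [Finset.coe_insert]
    refine hstep F j X P L hj (hS.slice_of_support hL fun i hi => ?_) hP hL hT (ih P fun i hi => ?_)
    · obtain ⟨h₁, h₂⟩ := S.support_right hP hL hT hi
      have := hX h₁
      simp only [Finset.coe_insert, Set.mem_insert_iff, Finset.mem_coe] at this
      exact this.resolve_right fun h => h₂ (hj i h)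
    · obtain ⟨h₁, h₂⟩ := S.support_left hP hL hT hi
      have := hX h₁
      simp only [Finset.coe_insert, Set.mem_insert_iff, Finset.mem_coe] at this
      exact this.resolve_left fun h => ne_of_gt (show j < i from h₂) h

end Slicing

end

lemma hom_shift_neg_eq_zero {C : Type u} [Category.{v} C] [Preadditive C] [HasShift C ℤ]
    [∀ n : ℤ, (shiftFunctor C n).Additive] {X Y : C} (h : ∀ f : X ⟶ Y⟦(1 : ℤ)⟧, f = 0)
    (f : X⟦(-1 : ℤ)⟧ ⟶ Y) : f = 0 := by
  apply (shiftFunctor C (1 : ℤ)).map_injective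
  rw [Functor.map_zero, ← cancel_epi (shiftNegShift X (1 : ℤ)).inv, comp_zero]
  exact h _

section

variable {C : Type u} [Category.{v} C] [Preadditive C] [HasZeroObject C] [HasShift C ℤ]
  [∀ n : ℤ, (shiftFunctor C n).Additive] [Pretriangulated C]

lemma IsExtension.isZero_right {A X B : C} (h : IsExtension A X B) (h₁ : ∀ f : X ⟶ B, f = 0)
    (h₂ : ∀ f : A⟦(1 : ℤ)⟧ ⟶ B, f = 0) : IsZero B := by
  rw [IsZero.iff_id_eq_zero]
  exact h.rotate.hom_from_eq_zero h₁ h₂ _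

lemma IsExtension.isZero_left {A X B : C} (h : IsExtension A X B) (h₁ : ∀ f : A ⟶ X, f = 0)
    (h₂ : ∀ f : A ⟶ B⟦(-1 : ℤ)⟧, f = 0) : IsZero A := by
  rw [IsZero.iff_id_eq_zero]
  exact h.invRotate.hom_to_eq_zero h₂ h₁ _

/-! ### Objects built from slices, and reordering of slices -/

namespace Slicing

variable {J : Type w} [LinearOrder J] {act : ZAction J} (S : Slicing C J act)

/-- The objects of the slices with index in `s`. -/
def slices (s : Set J) : ObjectProperty C := fun X => ∃ j ∈ s, S.slice j X

variable {S}

lemma slices_mono {s s' : Set J} (h : s ⊆ s') (X : C) : S.slices s X → S.slices s' X :=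
  fun ⟨j, hj, hX⟩ => ⟨j, h hj, hX⟩

lemma isLE_of_slices {V : UpperSet J} {s : Set J} (hs : s ⊆ V) {X : C}
    (hX : extClosure (S.slices s) X) : (S.ts V).IsLE X 0 := by
  refine hX.induct (fun X hX => isLE_of_isZero _ hX 0) ?_
    fun X Y Z h => isLE_of_isExtension _ h 0
  rintro X ⟨j, hj, hX⟩
  exact S.isLE_ts_of_le (le_Ici (hs hj)) ⟨hX.1⟩

lemma isGE_of_slices {V : UpperSet J} {s : Set J} (hs : s ⊆ (V : Set J)ᶜ) {X : C}
    (hX : extClosure (S.slices s) X) : (S.ts V).IsGE X 1 := by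
  refine hX.induct (fun X hX => isGE_of_isZero _ hX 1) ?_
    fun X Y Z h => isGE_of_isExtension _ h 1
  rintro X ⟨j, hj, hX⟩
  exact S.isGE_ts_of_le (U := UpperSet.Ioi j) (V := V) (fun k hk => lt_of_not_ge fun hkj => hs hj (V.upper hkj hk))
    ⟨hX.2⟩

lemma slice_hom_eq_zero {i j : J} (hij : j < i) {X Y : C} (hX : S.slice i X) (hY : S.slice j Y)
    (f : X ⟶ Y) : f = 0 :=
  (S.ts (UpperSet.Ioi j)).zero' f (S.monotone_ts _ _ (le_Ici (V := UpperSet.Ioi j) hij) X hX.1)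
    hY.2

variable (S) in
/-- Slices with index in `a` have no extensions by slices of larger index outside of `a`. -/
def ExtVanishing (a : Set J) : Prop :=
  ∀ i ∈ a, ∀ j ∉ a, i < j → ∀ X Y : C, S.slice i X → S.slice j Y →
    ∀ f : X ⟶ Y⟦(1 : ℤ)⟧, f = 0

lemma ExtVanishing.hom_eq_zero {a s s' : Set J} (ha : S.ExtVanishing a)
    (h : ∀ i ∈ s, ∀ j ∈ s', i < j) {X Y : C} (hX : extClosure (S.slices (s ∩ a)) X)
    (hY : extClosure (S.slices (s' ∩ aᶜ)) Y) (f : X ⟶ Y⟦(1 : ℤ)⟧) : f = 0 := by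
  refine hX.hom_shift_eq_zero 1 hY ?_ f
  rintro X Y ⟨i, hi, hX⟩ ⟨j, hj, hY⟩
  exact ha i hi.2 j hj.2 (h i hi.1 j hj.1) X Y hX hY

variable [IsTriangulated C]

/-- Every object is an extension of an object built from slices outside of `a` by an object built
from slices in `a`. -/
lemma IsBridgeland.exists_isExtension (hS : S.IsBridgeland) {a : Set J} (ha : S.ExtVanishing a)
    (X : C) : ∃ A B, IsExtension A X B ∧ extClosure (S.slices (S.support X ∩ a)) A ∧
      extClosure (S.slices (S.support X ∩ aᶜ)) B := by
  have key := hS.induction (R := fun s X => ∃ A B, IsExtension A X B ∧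
    extClosure (S.slices (s ∩ a)) A ∧ extClosure (S.slices (s ∩ aᶜ)) B) ?_ ?_ (hS X).1.toFinset X
    (by rw [Set.Finite.coe_toFinset]; exact subset_rfl)
  · rwa [Set.Finite.coe_toFinset] at key
  · exact fun X hX => ⟨X, X, .of_isZero_right X hX, .zero X hX, .zero X hX⟩
  · rintro s j X P L hj hL - - hT ⟨A, B, hP, hA, hB⟩
    have hs : s ⊆ insert j s := Set.subset_insert j s
    have hA' := hA.mono (slices_mono (Set.inter_subset_inter_left a hs))
    have hB' := hB.mono (slices_mono (Set.inter_subset_inter_left aᶜ hs))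
    obtain ⟨N, h₁, h₂⟩ := hP.assoc_right hT
    -- `N` is an extension of `L` by `B`. If `j ∈ a`, this extension splits because the indices of
    -- `B` exceed `j` and lie outside `a`; `L` then moves left and joins `A`.
    by_cases hja : j ∈ a
    · have hLB : ∀ f : L ⟶ B⟦(1 : ℤ)⟧, f = 0 :=
        ha.hom_eq_zero (s := {j}) (s' := s) (by simpa using hj) (.of L ⟨j, ⟨rfl, hja⟩, hL⟩) hB
      obtain ⟨A', h₃, h₄⟩ := h₁.assoc_left (h₂.swap hLB)
      exact ⟨A', B, h₄, .ofIsExtension h₃ hA' (.of L ⟨j, ⟨Set.mem_insert j s, hja⟩, hL⟩), hB'⟩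
    · exact ⟨A, N, h₁, hA',
        .ofIsExtension h₂ hB' (.of L ⟨j, ⟨Set.mem_insert j s, hja⟩, hL⟩)⟩

/-- The truncations of the slicing preserve the upper subcategory of a t-structure that is
generated by slices. -/
lemma IsBridgeland.isLE_truncations (hS : S.IsBridgeland) {a : Set J} (ha : S.ExtVanishing a)
    {s : TStructure C} {k : ℤ} (hle : s.le k = extClosure (S.slices a))
    (hge : s.ge (k + 1) = extClosure (S.slices aᶜ)) {V : UpperSet J} {P X Q : C}
    (hP : (S.ts V).IsLE P 0) (hQ : (S.ts V).IsGE Q 1) (hT : IsExtension P X Q)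
    (hX : s.IsLE X k) : s.IsLE P k ∧ s.IsLE Q k := by
  have sle : ∀ {s' : Set J} {Y : C}, extClosure (S.slices (s' ∩ a)) Y → s.IsLE Y k :=
    fun h => ⟨by rw [hle]; exact h.mono (slices_mono Set.inter_subset_right)⟩
  have sge : ∀ {s' : Set J} {Y : C}, extClosure (S.slices (s' ∩ aᶜ)) Y → s.IsGE Y (k + 1) :=
    fun h => ⟨by rw [hge]; exact h.mono (slices_mono Set.inter_subset_right)⟩
  have right : ∀ {A Y B : C}, IsExtension A Y B → s.IsLE A k → s.IsGE B (k + 1) →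
      (∀ f : Y ⟶ B, f = 0) → IsZero B := fun {A Y B} h hA hB h0 => by
    have := s.isLE_shift A k 1 (k - 1)
    exact h.isZero_right h0 fun f => s.zero f (k - 1) (k + 1)
  have suppP := (S.support_left hP hQ hT).trans Set.inter_subset_right
  have suppQ := (S.support_right hP hQ hT).trans Set.inter_subset_right
  obtain ⟨A, B, hAB, hA, hB⟩ := hS.exists_isExtension ha Q
  obtain ⟨A', B', hAB', hA', hB'⟩ := hS.exists_isExtension ha P
  -- `Q` is an extension of P[1] by `X`. Both are orthogonal to `B`: `X` by the t-structure `s`,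
  -- P[1] by the slicing, as `B` uses only slices outside `V`.
  have hB0 : IsZero B := by
    have := sge hB
    have := S.isGE_of_slices (Set.inter_subset_left.trans suppQ) hB
    have := (S.ts V).isLE_shift P 0 1 (-1)
    exact right hAB (sle hA) (sge hB) (hT.rotate.hom_from_eq_zero
      (fun f => s.zero f k (k + 1)) fun f => (S.ts V).zero f (-1) 1)
  have hQa := extClosure.ofIsExtension hAB hA (.zero B hB0)
  -- `P` is an extension of `X` by Q[-1]. Now that `Q` is known to be built from slices in `a`
  -- outside `V`, `ExtVanishing` gives Hom(Q, B'[1]) = 0; this is why `Q` is treated before `P`.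
  have hB'0 : IsZero B' := by
    have := sge hB'
    exact right hAB' (sle hA') (sge hB') (hT.invRotate.hom_from_eq_zero
      (hom_shift_neg_eq_zero (ha.hom_eq_zero (fun i hi j hj => lt_of_not_ge
        fun hij => suppQ hi (V.upper hij (suppP hj))) hQa hB')) fun f => s.zero f k (k + 1))
  exact ⟨sle (.ofIsExtension hAB' hA' (.zero B' hB'0)), sle hQa⟩

/-- The truncations of the slicing preserve the lower subcategory of a t-structure that is
generated by slices. -/
lemma IsBridgeland.isGE_truncations (hS : S.IsBridgeland) {a : Set J} (ha : S.ExtVanishing a)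
    {s : TStructure C} {k : ℤ} (hle : s.le k = extClosure (S.slices a))
    (hge : s.ge (k + 1) = extClosure (S.slices aᶜ)) {V : UpperSet J} {P X Q : C}
    (hP : (S.ts V).IsLE P 0) (hQ : (S.ts V).IsGE Q 1) (hT : IsExtension P X Q)
    (hX : s.IsGE X (k + 1)) : s.IsGE P (k + 1) ∧ s.IsGE Q (k + 1) := by
  have sle : ∀ {s' : Set J} {Y : C}, extClosure (S.slices (s' ∩ a)) Y → s.IsLE Y k :=
    fun h => ⟨by rw [hle]; exact h.mono (slices_mono Set.inter_subset_right)⟩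
  have sge : ∀ {s' : Set J} {Y : C}, extClosure (S.slices (s' ∩ aᶜ)) Y → s.IsGE Y (k + 1) :=
    fun h => ⟨by rw [hge]; exact h.mono (slices_mono Set.inter_subset_right)⟩
  have left : ∀ {A Y B : C}, IsExtension A Y B → s.IsLE A k → s.IsGE B (k + 1) →
      (∀ f : A ⟶ Y, f = 0) → IsZero A := fun {A Y B} h hA hB h0 => by
    have := s.isGE_shift B (k + 1) (-1) (k + 2)
    exact h.isZero_left h0 fun f => s.zero f k (k + 2)
  have suppP := (S.support_left hP hQ hT).trans Set.inter_subset_right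
  have suppQ := (S.support_right hP hQ hT).trans Set.inter_subset_right
  obtain ⟨A, B, hAB, hA, hB⟩ := hS.exists_isExtension ha P
  obtain ⟨A', B', hAB', hA', hB'⟩ := hS.exists_isExtension ha Q
  -- The dual argument treats `P` first: `P` is an extension of `X` by Q[-1], and `A`, built from
  -- slices inside `V`, has no morphisms to either.
  have hA0 : IsZero A := by
    have := sle hA
    have := S.isLE_of_slices (Set.inter_subset_left.trans suppP) hA
    have := (S.ts V).isGE_shift Q 1 (-1) 2
    exact left hAB (sle hA) (sge hB) (hT.invRotate.hom_to_eq_zero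
      (fun f => (S.ts V).zero f 0 2) fun f => s.zero f k (k + 1))
  have hPa := extClosure.ofIsExtension hAB (.zero A hA0) hB
  have hA'0 : IsZero A' := by
    have := sle hA'
    exact left hAB' (sle hA') (sge hB') (hT.rotate.hom_to_eq_zero
      (fun f => s.zero f k (k + 1)) (ha.hom_eq_zero (fun i hi j hj => lt_of_not_ge
        fun hij => suppQ hi (V.upper hij (suppP hj))) hA' hPa))
  exact ⟨sge hPa, sge (.ofIsExtension hAB' (.zero A' hA'0) hB')⟩

/-- An object which is bounded by a t-structure generated by slices on both sides is built from the
slices within these bounds. -/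
lemma IsBridgeland.extClosure_of_isLE_of_isGE (hS : S.IsBridgeland) {a b : Set J}
    (ha : S.ExtVanishing a) (hb : S.ExtVanishing b) {s : TStructure C} {k l : ℤ}
    (hlea : s.le k = extClosure (S.slices a)) (hgea : s.ge (k + 1) = extClosure (S.slices aᶜ))
    (hleb : s.le l = extClosure (S.slices b)) (hgeb : s.ge (l + 1) = extClosure (S.slices bᶜ))
    {X : C} (hle : s.IsLE X k) (hge : s.IsGE X (l + 1)) :
    extClosure (S.slices (S.support X ∩ (a ∩ bᶜ))) X := by
  have key := hS.induction (R := fun s' X => s.IsLE X k → s.IsGE X (l + 1) →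
    extClosure (S.slices (s' ∩ (a ∩ bᶜ))) X) ?_ ?_ (hS X).1.toFinset X
    (by rw [Set.Finite.coe_toFinset]; exact subset_rfl)
  · rw [Set.Finite.coe_toFinset] at key
    exact key hle hge
  · exact fun X hX _ _ => .zero X hX
  · rintro s' j X P L - hLj hP hL hT ih hle hge
    obtain ⟨leP, leL⟩ := hS.isLE_truncations ha hlea hgea hP hL hT hle
    obtain ⟨geP, geL⟩ := hS.isGE_truncations hb hleb hgeb hP hL hT hge
    refine .ofIsExtension hT ((ih leP geP).mono
      (slices_mono (Set.inter_subset_inter_left _ (Set.subset_insert j s')))) ?_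
    -- The slice object `L` obeys both bounds; were `j` outside `a` or inside `b`, it would lie in
    -- two orthogonal halves of `s` and be zero.
    by_cases hja : j ∈ a
    · by_cases hjb : j ∈ b
      · have : s.IsLE L l := ⟨by rw [hleb]; exact .of L ⟨j, hjb, hLj⟩⟩
        exact .zero L (s.isZero L l (l + 1))
      · exact .of L ⟨j, ⟨Set.mem_insert j s', hja, hjb⟩, hLj⟩
    · have : s.IsGE L (k + 1) := ⟨by rw [hgea]; exact .of L ⟨j, hja, hLj⟩⟩
      exact .zero L (s.isZero L k (k + 1))

end Slicing

end

/-! ### Lexicographic indices, shifts and the glued t-structure -/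

section

variable {C : Type u} [Category.{v} C] [Preadditive C] [HasZeroObject C] [HasShift C ℤ]
  [∀ n : ℤ, (shiftFunctor C n).Additive] [Pretriangulated C]

lemma lt_lexIndex_iff {i j : LexIndex} :
    i < j ↔ (ofLex i).1 < (ofLex j).1 ∨
      (ofLex i).1 = (ofLex j).1 ∧ (ofLex i).2 < (ofLex j).2 :=
  Prod.Lex.lt_iff

/-- The indices whose translate by `k` lies in the upper set `A` of the product order. -/
def translatedIndices (A : UpperSet (ℤ × ℤ)) (k : ℤ) : Set LexIndex :=
  {i | ((ofLex i).1 + k, (ofLex i).2) ∈ A}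

lemma translatedIndices_mono (A : UpperSet (ℤ × ℤ)) {k l : ℤ} (h : k ≤ l) :
    translatedIndices A k ⊆ translatedIndices A l :=
  fun _ hi => A.upper (Prod.mk_le_mk.2 ⟨by omega, le_rfl⟩) hi

/-- Otherwise `j` would dominate `i` in the product order. This supplies the strict inequality of
second coordinates that gluability requires. -/
lemma translatedIndices.lt {A : UpperSet (ℤ × ℤ)} {k : ℤ} {i j : LexIndex}
    (hi : i ∈ translatedIndices A k) (hj : j ∉ translatedIndices A k)
    (h : (ofLex i).1 ≤ (ofLex j).1) : (ofLex j).2 < (ofLex i).2 :=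
  lt_of_not_ge fun h' => hj (A.upper (Prod.mk_le_mk.2 ⟨by omega, h'⟩) hi)

/-- The upper set of all `(m, φ)` with `m ≥ n`. -/
def upperSetGE (n : ℤ) : UpperSet LexIndex where
  carrier := {x | n ≤ (ofLex x).1}
  upper' := by
    intro a b hab ha
    have h := Prod.Lex.le_iff.1 hab
    simp only [Set.mem_ofPred_eq] at ha ⊢
    omega

lemma mem_upperSetGE {n : ℤ} {i : LexIndex} : i ∈ upperSetGE n ↔ n ≤ (ofLex i).1 := Iff.rfl

lemma map_shift_eq {V W : UpperSet LexIndex}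
    (h : ∀ m φ : ℤ, toLex (m, φ) ∈ V ↔ toLex (m + 1, φ) ∈ W) :
    UpperSet.map lexAction.shift V = W := by
  refine SetLike.ext fun x => ?_
  have h' := h ((ofLex x).1 - 1) (ofLex x).2
  rw [sub_add_cancel] at h'
  exact UpperSet.mem_map.trans h'

namespace Slicing

variable (S : Slicing C LexIndex lexAction)

/-- Equivariance of the slicing concerns a translation by one; induction on `n` in both directions
gives all translations. -/
lemma ts_le_ge (V : ℤ → UpperSet LexIndex)
    (hV : ∀ n m φ : ℤ, toLex (m, φ) ∈ V n ↔ toLex (m + 1, φ) ∈ V (n + 1)) (n m : ℤ) :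
    (S.ts (V n)).le m = (S.ts (V 0)).le (m - n) ∧
      (S.ts (V n)).ge m = (S.ts (V 0)).ge (m - n) := by
  have step : ∀ n m, (S.ts (V (n + 1))).le m = (S.ts (V n)).le (m - 1) ∧
      (S.ts (V (n + 1))).ge m = (S.ts (V n)).ge (m - 1) := fun n m => by
    rw [← map_shift_eq (hV n), S.ts_shift]
    exact ⟨rfl, rfl⟩
  induction n using Int.induction_on generalizing m with
  | zero => simp
  | succ n ih =>
    rw [(step n m).1, (step n m).2, (ih _).1, (ih _).2]
    simp [sub_sub, add_comm]
  | pred n ih =>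
    have h := step (-(n : ℤ) - 1) (m + 1)
    rw [sub_add_cancel, add_sub_cancel_right] at h
    rw [← h.1, ← h.2, (ih _).1, (ih _).2, show m + 1 - -(n : ℤ) = m - (-(n : ℤ) - 1) by ring]
    exact ⟨rfl, rfl⟩

lemma slice_shift {n φ : ℤ} {X : C} (hX : S.slice (toLex (n, φ)) X) (k m : ℤ) (h : n + k = m) :
    S.slice (toLex (m, φ)) (X⟦k⟧) := by
  have h₁ := S.ts_le_ge (fun n => UpperSet.Ici (toLex (n, φ)))
    (fun n m ψ => by simp [Prod.Lex.le_iff])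
  have h₂ := S.ts_le_ge (fun n => UpperSet.Ioi (toLex (n, φ)))
    (fun n m ψ => by simp [Prod.Lex.lt_iff])
  obtain ⟨hX₁, hX₂⟩ := hX
  rw [(h₁ _ _).1] at hX₁
  rw [(h₂ _ _).2] at hX₂
  constructor
  · rw [(h₁ _ _).1]
    exact TStructure.le_shift _ _ _ _ (by omega) _ hX₁
  · rw [(h₂ _ _).2]
    exact TStructure.ge_shift _ _ _ _ (by omega) _ hX₂

lemma slices_shift {A : UpperSet (ℤ × ℤ)} {n k m : ℤ} (h : k + m = n) {X : C}
    (hX : S.slices (translatedIndices A n) X) :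
    S.slices (translatedIndices A m) (X⟦k⟧) := by
  obtain ⟨⟨l, φ⟩, hl, hX⟩ := hX
  refine ⟨toLex (l + k, φ), ?_, S.slice_shift hX k _ rfl⟩
  have e : l + k + m = l + n := by omega
  change (l + k + m, φ) ∈ A
  rw [e]
  exact hl

lemma slices_compl_shift {A : UpperSet (ℤ × ℤ)} {n k m : ℤ} (h : k + m = n) {X : C}
    (hX : S.slices (translatedIndices A n)ᶜ X) :
    S.slices (translatedIndices A m)ᶜ (X⟦k⟧) := by
  obtain ⟨⟨l, φ⟩, hl, hX⟩ := hX
  refine ⟨toLex (l + k, φ), ?_, S.slice_shift hX k _ rfl⟩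
  have e : l + k + m = l + n := by omega
  change ¬ (l + k + m, φ) ∈ A
  rw [e]
  exact hl

end Slicing

namespace AbelianSlicing

variable {t : TStructure C} {S : AbelianSlicing t}

lemma IsGluable.hom_eq_zero (hS : S.IsGluable) {n m φ ψ : ℤ} (hψ : ψ < φ) (hn : n < m) {X Y : C}
    (hX : S.sliceAt n φ X) (hY : S.sliceAt m ψ Y) (f : X ⟶ Y) : f = 0 := by
  apply (shiftFunctor C (-n)).map_injective
  have h := hS φ ψ (m - n) hψ (by omega) _ _
    (S.slice_shift hX (-n) 0 (by omega)) (S.slice_shift hY (-m) 0 (by omega))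
    (f⟦-n⟧' ≫ ((shiftFunctorAdd' C (-m) (m - n) (-n) (by omega)).app Y).hom)
  rw [Functor.map_zero]
  exact (cancel_mono _).1 (h.trans zero_comp.symm)

/-- For (n, φ) < (m, ψ) one has n ≤ m, hence ψ < φ since `A` is an upper set. The shift by one turns
n ≤ m into the strict n < m + 1, so gluability applies even when n = m. -/
lemma IsGluable.extVanishing (hS : S.IsGluable) (A : UpperSet (ℤ × ℤ)) (k : ℤ) :
    S.ExtVanishing (translatedIndices A k) := by
  rintro ⟨n, φ⟩ hi ⟨m, ψ⟩ hj hij X Y hX hY f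
  have hnm : n ≤ m := by
    rcases lt_lexIndex_iff.1 hij with h | h
    exacts [h.le, h.1.le]
  exact hS.hom_eq_zero (translatedIndices.lt hi hj hnm) (Int.lt_add_one_iff.2 hnm) hX
    (S.slice_shift hY 1 (m + 1) rfl) f

/-- Two mechanisms cover all cases: gluability if n < m, the orthogonality of the slicing if n ≥ m.
For n = m the inequality ψ < φ makes the source lexicographically larger. -/
lemma IsGluable.slices_hom_eq_zero (hS : S.IsGluable) (A : UpperSet (ℤ × ℤ)) (k : ℤ) {X Y : C}
    (hX : S.slices (translatedIndices A k) X) (hY : S.slices (translatedIndices A k)ᶜ Y)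
    (f : X ⟶ Y) : f = 0 := by
  obtain ⟨⟨n, φ⟩, hi, hX⟩ := hX
  obtain ⟨⟨m, ψ⟩, hj, hY⟩ := hY
  rcases lt_or_ge n m with h | h
  · exact hS.hom_eq_zero (translatedIndices.lt hi hj h.le) h hX hY f
  · refine Slicing.slice_hom_eq_zero (lt_lexIndex_iff.2 ?_) hX hY f
    rcases h.lt_or_eq with h | h
    · exact Or.inl h
    · exact Or.inr ⟨h, translatedIndices.lt hi hj h.ge⟩

variable (S) in
lemma ts_upperSetGE (n m : ℤ) :
    (S.ts (upperSetGE n)).le m = t.le (m - n) ∧ (S.ts (upperSetGE n)).ge m = t.ge (m - n) := by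
  have h := S.ts_le_ge upperSetGE (fun n m φ => by simp [mem_upperSetGE]) n m
  rwa [show S.ts (upperSetGE 0) = t from S.ts_nonneg] at h

variable [IsTriangulated C]

/-- The t-structure glued along the upper set `A`. -/
def IsGluable.tStructure (hS : S.IsGluable) (A : UpperSet (ℤ × ℤ)) : TStructure C where
  le k := extClosure (S.slices (translatedIndices A k))
  ge k := extClosure (S.slices (translatedIndices A (k - 1))ᶜ)
  le_shift _ a _ h _ hX := hX.shift a fun _ => S.slices_shift h
  ge_shift _ a _ h _ hX := hX.shift a fun _ => S.slices_compl_shift (by omega)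
  zero' _ _ f hX hY := hX.hom_eq_zero hY (fun _ _ => hS.slices_hom_eq_zero A 0) f
  le_zero_le _ hX := hX.mono (Slicing.slices_mono (translatedIndices_mono A (by omega)))
  ge_one_le _ hX := hX.mono (Slicing.slices_mono
    (Set.compl_subset_compl.2 (translatedIndices_mono A (by omega))))
  exists_triangle_zero_one X := by
    obtain ⟨P, Q, ⟨f, g, h, hT⟩, hP, hQ⟩ :=
      S.isBridgeland.exists_isExtension (hS.extVanishing A 0) X
    exact ⟨P, Q, hP.mono (Slicing.slices_mono Set.inter_subset_right),
      hQ.mono (Slicing.slices_mono Set.inter_subset_right), f, g, h, hT⟩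

lemma IsGluable.tStructure_le (hS : S.IsGluable) (A : UpperSet (ℤ × ℤ)) (k : ℤ) :
    (hS.tStructure A).le k = extClosure (S.slices (translatedIndices A k)) := rfl

lemma IsGluable.tStructure_ge (hS : S.IsGluable) (A : UpperSet (ℤ × ℤ)) (k : ℤ) :
    (hS.tStructure A).ge (k + 1) = extClosure (S.slices (translatedIndices A k)ᶜ) := by
  change extClosure (S.slices (translatedIndices A (k + 1 - 1))ᶜ) = _
  rw [add_sub_cancel_right]

/-- The truncations of `t` preserve the heart of a glued t-structure. -/
lemma IsGluable.heart_truncations (hS : S.IsGluable) (A : UpperSet (ℤ × ℤ)) {P X Q : C} {n : ℤ}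
    (hP : t.IsLE P n) (hQ : t.IsGE Q (n + 1)) (hT : IsExtension P X Q)
    (hX : (hS.tStructure A).heart X) :
    (hS.tStructure A).heart P ∧ (hS.tStructure A).heart Q := by
  rw [TStructure.mem_heart_iff] at *
  rw [TStructure.mem_heart_iff]
  -- The truncation of `t` at `n` is the one that the slicing assigns to the first coordinates `≥
  -- -n`, so the results on slicings apply to it.
  have hP' : (S.ts (upperSetGE (-n))).IsLE P 0 :=
    ⟨by rw [(S.ts_upperSetGE _ _).1]; simpa using hP.le⟩
  have hQ' : (S.ts (upperSetGE (-n))).IsGE Q 1 :=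
    ⟨by rw [(S.ts_upperSetGE _ _).2, sub_neg_eq_add, add_comm]; exact hQ.ge⟩
  have h₁ := S.isBridgeland.isLE_truncations (hS.extVanishing A 0) (hS.tStructure_le A 0)
    (hS.tStructure_ge A 0) hP' hQ' hT hX.1
  have h₂ := S.isBridgeland.isGE_truncations (hS.extVanishing A (-1)) (hS.tStructure_le A (-1))
    (hS.tStructure_ge A (-1)) hP' hQ' hT hX.2
  exact ⟨⟨h₁.1, h₂.1⟩, h₁.2, h₂.2⟩

lemma IsGluable.tCohomology_of_heart (hS : S.IsGluable) (A : UpperSet (ℤ × ℤ)) {X : C}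
    (hX : (hS.tStructure A).heart X) (n : ℤ) :
    extClosure (fun Y => ∃ φ, (n, φ) ∈ A ∧ (n - 1, φ) ∉ A ∧ S.heartSlice φ Y)
      (((tCohomology t n).obj X)⟦-n⟧) := by
  have h₁ := (hS.heart_truncations (n := -n) A inferInstance inferInstance
    (isExtension_truncLE_truncGE t X (-n) (-n + 1) rfl) hX).1
  have h₂ := (hS.heart_truncations (n := -n - 1) A inferInstance
    (by rw [sub_add_cancel]; infer_instance) (isExtension_truncLE_truncGE t
      ((t.truncLE (-n)).obj X) (-n - 1) (-n) (by omega)) h₁).2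
  change (hS.tStructure A).heart ((tCohomology t n).obj X) at h₂
  have hle : t.IsLE ((tCohomology t n).obj X) (-n) := by
    dsimp only [tCohomology, Functor.comp_obj]
    infer_instance
  have hge : t.IsGE ((tCohomology t n).obj X) (-n) := by
    dsimp only [tCohomology, Functor.comp_obj]
    infer_instance
  have s₁ := S.support_subset_of_isLE (V := upperSetGE n) (X := (tCohomology t n).obj X)
    ⟨by rw [(S.ts_upperSetGE _ _).1, zero_sub]; exact hle.le⟩
  have s₂ := S.support_subset_of_isGE (V := upperSetGE (n + 1)) (X := (tCohomology t n).obj X)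
    ⟨by rw [(S.ts_upperSetGE _ _).2, show 1 - (n + 1) = -n by ring]; exact hge.ge⟩
  rw [TStructure.mem_heart_iff] at h₂
  -- The heart is bounded by the translates of `A` by 0 and by -1, while the support of the
  -- cohomology has first coordinate exactly `n`.
  refine (S.isBridgeland.extClosure_of_isLE_of_isGE (hS.extVanishing A 0) (hS.extVanishing A (-1))
    (hS.tStructure_le A 0) (hS.tStructure_ge A 0) (hS.tStructure_le A (-1))
    (hS.tStructure_ge A (-1)) h₂.1 h₂.2).shift (-n) ?_
  rintro Y ⟨⟨m, φ⟩, ⟨hm, hA, hA'⟩, hY⟩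
  have hm₁ : n ≤ m := s₁ hm
  have hm₂ : ¬ n + 1 ≤ m := s₂ hm
  obtain rfl : m = n := by omega
  refine ⟨φ, ?_, hA', S.slice_shift hY _ _ (by omega)⟩
  have : (m + 0, φ) ∈ A := hA
  rwa [add_zero] at this

/-- Climb the truncations of `X` from the lower bound `a`, where they vanish, adding one cohomology
at each step until the truncation is `X`. -/
lemma extClosure_of_tCohomology {P : ObjectProperty C} {X : C} (hX : t.bounded X)
    (h : ∀ n, extClosure P ((tCohomology t n).obj X)) : extClosure P X := by
  obtain ⟨⟨a, ha⟩, b, hb⟩ := hX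
  have key : ∀ m, a ≤ m → extClosure P ((t.truncLT m).obj X) := by
    intro m hm
    induction m, hm using Int.leInduction with
    | base => exact .zero _ (t.isZero_truncLT_obj_of_isGE a X)
    | succ m hm ih =>
      have h' := h (-m)
      dsimp only [tCohomology] at h'
      rw [neg_neg] at h'
      exact .ofIsExtension ⟨_, _, _, t.triangleLTLTGELT_distinguished m (m + 1) (by omega) X⟩ ih h'
  -- Nothing gives `a ≤ b` (`X` may be zero), so the maximum ensures that the climb starting at `a`
  -- reaches this degree.
  have hb' : t.IsLE X (max a b) := t.isLE_of_le X b _ (le_max_right a b)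
  have : IsIso ((t.truncLEι (max a b)).app X) := inferInstance
  exact (key (max a b + 1) (by omega)).of_iso (asIso ((t.truncLEι (max a b)).app X))

/-- The heart of a glued t-structure in terms of the cohomologies for `t`. -/
lemma IsGluable.heart_iff (hS : S.IsGluable) (A : UpperSet (ℤ × ℤ)) {X : C} (hX : t.bounded X) :
    (hS.tStructure A).heart X ↔ ∀ n : ℤ,
      extClosure (fun Y => ∃ φ, (n, φ) ∈ A ∧ (n - 1, φ) ∉ A ∧ S.heartSlice φ Y)
        (((tCohomology t n).obj X)⟦-n⟧) := by
  refine ⟨fun h n => hS.tCohomology_of_heart A h n, fun h => ?_⟩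
  have h' : extClosure (S.slices (translatedIndices A 0 ∩ (translatedIndices A (-1))ᶜ)) X := by
    refine extClosure_of_tCohomology hX fun n => ?_
    refine ((h n).shift (Q := S.slices (translatedIndices A 0 ∩ (translatedIndices A (-1))ᶜ))
      n ?_).of_iso (shiftNegShift ((tCohomology t n).obj X) n)
    rintro Y ⟨φ, h₁, h₂, hY⟩
    refine ⟨toLex (n, φ), ⟨?_, h₂⟩, S.slice_shift hY n n (zero_add n)⟩
    change (n + 0, φ) ∈ A
    rwa [add_zero]
  exact ⟨h'.mono (Slicing.slices_mono Set.inter_subset_left),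
    h'.mono (Slicing.slices_mono Set.inter_subset_right)⟩

end AbelianSlicing

/-- A t-structure is determined by its subcategories of degree `≤ 0` and `≥ 1`. -/
lemma tStructure_ext {s s' : TStructure C} (hle : s.le 0 = s'.le 0) (hge : s.ge 1 = s'.ge 1) :
    s = s' := by
  have h₁ : s.le = s'.le := by
    funext n
    rw [← s.shift_le n 0 n (by omega), ← s'.shift_le n 0 n (by omega), hle]
  have h₂ : s.ge = s'.ge := by
    funext n
    rw [← s.shift_ge (n - 1) 1 n (by omega), ← s'.shift_ge (n - 1) 1 n (by omega), hge]
  cases s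
  cases s'
  subst h₁ h₂
  rfl

/-! ### The t-structure of a perversity -/

lemma monotone_perversityOf (U : UpperSet (ℤ × ℤ)) : Monotone (perversityOf U) := by
  refine monotone_int_of_le_succ fun n => ?_
  rcases (existsUnique_perversity U).choose_spec.1.1 with ⟨q, hq, h⟩ | h | h
  · change (existsUnique_perversity U).choose n ≤ (existsUnique_perversity U).choose (n + 1)
    rw [h, h]
    exact WithBotTop.coe_le_coe.2 (hq n).1
  · exact ((h n).trans (h (n + 1)).symm).le
  · exact ((h n).trans (h (n + 1)).symm).le

/-- The upper set of all `(n, φ)` with `n + p(φ) ≥ 0`. -/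
def perverseUpperSet (p : ℤ → EInt) (hp : Monotone p) : UpperSet (ℤ × ℤ) where
  carrier := {x | ((-x.1 : ℤ) : EInt) ≤ p x.2}
  upper' := fun _ _ hxy hx =>
    (WithBotTop.coe_le_coe.2 (neg_le_neg hxy.1)).trans (hx.trans (hp hxy.2))

lemma mem_perverseUpperSet {p : ℤ → EInt} {hp : Monotone p} {n φ : ℤ} :
    (n, φ) ∈ perverseUpperSet p hp ↔ ((-n : ℤ) : EInt) ≤ p φ := Iff.rfl

/-- With `m = -n` this identifies the two membership conditions that cut out the heart, (n, φ) ∈ A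
and (n - 1, φ) ∉ A, with p(φ) = -n. -/
lemma eint_eq_coe_iff (x : EInt) (m : ℤ) :
    x = (m : EInt) ↔ (m : EInt) ≤ x ∧ ¬ ((m + 1 : ℤ) : EInt) ≤ x := by
  induction x using WithBotTop.rec with
  | bot => simp [(WithBotTop.coe_ne_bot m).symm]
  | coe a =>
    rw [WithBotTop.coe_le_coe, WithBotTop.coe_le_coe, WithBotTop.coe_injective.eq_iff]
    omega
  | top => simp [(WithBotTop.coe_ne_top m).symm]

lemma AbelianSlicing.isPerverseTStructure_iff {t : TStructure C} (S : AbelianSlicing t)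
    {p : ℤ → EInt} (hp : Monotone p) (s : TStructure C) :
    S.IsPerverseTStructure p s ↔
      s.le 0 = extClosure (S.slices (translatedIndices (perverseUpperSet p hp) 0)) ∧
      s.ge 1 = extClosure (S.slices (translatedIndices (perverseUpperSet p hp) 0)ᶜ) := by
  have h₁ : (fun X => ∃ n φ : ℤ, ((-n : ℤ) : EInt) ≤ p φ ∧ S.sliceAt n φ X) =
      S.slices (translatedIndices (perverseUpperSet p hp) 0) := by
    funext X
    refine propext ⟨fun ⟨n, φ, h, hX⟩ => ⟨toLex (n, φ), ?_, hX⟩,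
      fun ⟨⟨n, φ⟩, h, hX⟩ => ⟨n, φ, ?_, hX⟩⟩
    · change ((-(n + 0) : ℤ) : EInt) ≤ p φ
      rwa [add_zero]
    · have : ((-(n + 0) : ℤ) : EInt) ≤ p φ := h
      rwa [add_zero] at this
  have h₂ : (fun X => ∃ n φ : ℤ, p φ < ((-n : ℤ) : EInt) ∧ S.sliceAt n φ X) =
      S.slices (translatedIndices (perverseUpperSet p hp) 0)ᶜ := by
    funext X
    refine propext ⟨fun ⟨n, φ, h, hX⟩ => ⟨toLex (n, φ), ?_, hX⟩,
      fun ⟨⟨n, φ⟩, h, hX⟩ => ⟨n, φ, ?_, hX⟩⟩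
    · change ¬ ((-(n + 0) : ℤ) : EInt) ≤ p φ
      rwa [add_zero, not_le]
    · have : ¬ ((-(n + 0) : ℤ) : EInt) ≤ p φ := h
      rwa [add_zero, not_le] at this
  rw [AbelianSlicing.IsPerverseTStructure, h₁, h₂]

end

end Perverse

theorem mainTheorem2 {C : Type u} [Category.{v} C] [Preadditive C] [HasZeroObject C]
    [HasShift C ℤ] [∀ n : ℤ, (shiftFunctor C n).Additive] [Pretriangulated C] [IsTriangulated C]
    (t : TStructure C) (ht : ∀ X : C, t.bounded X)
    (S : Perverse.AbelianSlicing t) (hS : S.IsGluable) (U : UpperSet (ℤ × ℤ)) :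
    (∃! s : TStructure C, S.IsPerverseTStructure (Perverse.perversityOf U) s) ∧
    ∀ s : TStructure C, S.IsPerverseTStructure (Perverse.perversityOf U) s →
      ∀ X : C, s.heart X ↔
        ∀ n : ℤ, Perverse.extClosure
          (fun Y => ∃ n' : ℤ, Perverse.perversityOf U n' = ((-n : ℤ) : EInt) ∧ S.heartSlice n' Y)
          (((Perverse.tCohomology t n).obj X)⟦-n⟧) := by
  have hp := Perverse.monotone_perversityOf U
  let A := Perverse.perverseUpperSet _ hp
  have hs : ∀ s : TStructure C, S.IsPerverseTStructure (Perverse.perversityOf U) s ↔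
      s = hS.tStructure A := by
    intro s
    rw [S.isPerverseTStructure_iff hp]
    refine ⟨fun h => Perverse.tStructure_ext (h.1.trans (hS.tStructure_le A 0).symm)
      (h.2.trans (hS.tStructure_ge A 0).symm), ?_⟩
    rintro rfl
    exact ⟨hS.tStructure_le A 0, hS.tStructure_ge A 0⟩
  refine ⟨⟨_, (hs _).2 rfl, fun s => (hs s).1⟩, fun s h X => ?_⟩
  obtain rfl := (hs s).1 h
  rw [hS.heart_iff A (ht X)]
  refine forall_congr' fun n => ?_
  have e : (fun Y => ∃ φ, (n, φ) ∈ A ∧ (n - 1, φ) ∉ A ∧ S.heartSlice φ Y) =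
      fun Y => ∃ n' : ℤ, Perverse.perversityOf U n' = ((-n : ℤ) : EInt) ∧ S.heartSlice n' Y := by
    funext Y
    refine propext (exists_congr fun φ => ?_)
    rw [Perverse.mem_perverseUpperSet, Perverse.mem_perverseUpperSet, Perverse.eint_eq_coe_iff,
      show -(n - 1) = -n + 1 by ring, and_assoc]
  rw [e]
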